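/- Let $\bar\Lambda=\mathbb C[p_0,p_1,p_2,\dots]$ be the commutative algebra over $\mathbb C$ with free generators $p_i$, $i\ge 0$ (the algebra of symmetric functions, freely generated by the power sums $p_1,p_2,\dots$, with an additional variable $p_0$ adjoined), and let $k\in\mathbb C$. On $\bar\Lambda[x]$ consider - the derivation $\partial$ over $\mathbb C$ with $\partial(x)=x$ and $\partial(p_l)=l\,x^l$ for $l\ge 0$; - the $\bar\Lambda$-linear operator $\Delta$ with $\Delta(1)=0$ and $$\Delta(x^l)=x^lp_0+2x^{l-1}p_1+\dots+2x\,p_{l-1}+p_l-2l\,x^l,\qquad l>0;$$ - the infinite-dimensional Dunkl–Heckman operator $D_k=\partial-\tfrac12 k\Delta$. Let $E:\bar\Lambda[x]\to\bar\Lambda$ be the $\bar\Lambda$-linear map with $E(x^l)=p_l$ for $l\ge 0$, and define $\mathcal L^{(r)}:\bar\Lambda\to\bar\Lambda$, $r\in\mathbb Z_{\ge 0}$, as the restriction of $E\circ D_k^r$ to $\bar\Lambda\subset\bar\Lambda[x]$. Then: 1. the operators $\mathcal L^{(r)}$ commute: $[\mathcal L^{(r)},\mathcal L^{(s)}]=0$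 for all $r,s\ge 0$; 2. $\mathcal L^{(2)}$ is the trigonometric Calogero–Moser–Sutherland operator at infinity, $$\mathcal L^{(2)}=\sum_{a,b>0}p_{a+b}\partial_a\partial_b-k\sum_{a,b>0}p_ap_b\,\partial_{a+b}+(1+k)\sum_{a>0}a\,p_a\partial_a-k\,p_0\sum_{a>0}p_a\partial_a,$$ where $\partial_a=a\,\frac{\partial}{\partial p_a}$ (each sum is finite when applied to an element of $\bar\Lambda$). -/

import Mathlib

open Polynomial

noncomputable section

namespace DunklHeckman

/-- The algebra `Λ̄ = Λ[p₀]` over `ℂ`: the commutative algebra with free generators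
`p i = MvPolynomial.X i`, `i ≥ 0` (`p₀` is an additional variable). -/
abbrev LambdaBar : Type := MvPolynomial ℕ ℂ

/-- The free generators (power sums) `p₀, p₁, p₂, …` of `Λ̄`. -/
abbrev p (l : ℕ) : LambdaBar := MvPolynomial.X l

/-- The restriction to `Λ̄` of the differentiation `∂`: the derivation `Λ̄ → Λ̄[x]` with
`p l ↦ l x ^ l`. -/
def partialCoeff : Derivation ℂ LambdaBar LambdaBar[X] :=
  MvPolynomial.mkDerivation ℂ fun l => (l : LambdaBar[X]) * X ^ l

/-- The `ℂ`-linear map `x ^ l f ↦ l x ^ l f + x ^ l ∂ f`, `f ∈ Λ̄`, underlying `∂`. -/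
def partialLin : LambdaBar[X] →ₗ[ℂ] LambdaBar[X] :=
  Polynomial.lsum fun l =>
    (LinearMap.mulLeft ℂ ((l : LambdaBar[X]) * X ^ l)) ∘ₗ
        (Polynomial.CAlgHom (R := ℂ) (A := LambdaBar)).toLinearMap
      + (LinearMap.mulLeft ℂ ((X : LambdaBar[X]) ^ l)) ∘ₗ
        (partialCoeff : LambdaBar →ₗ[ℂ] LambdaBar[X])

theorem partialLin_monomial (l : ℕ) (f : LambdaBar) :
    partialLin (monomial l f) = (l : LambdaBar[X]) * X ^ l * C f + X ^ l * partialCoeff f := by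
  simp [partialLin, Polynomial.lsum_apply, Polynomial.sum_monomial_index]
  ring

theorem partialLin_mul (u v : LambdaBar[X]) :
    partialLin (u * v) = u • partialLin v + v • partialLin u := by
  induction u using Polynomial.induction_on' with
  | add a b ha hb => rw [add_mul, map_add, ha, hb, map_add]; simp only [smul_eq_mul]; ring
  | monomial m f =>
    induction v using Polynomial.induction_on' with
    | add a b ha hb => rw [mul_add, map_add, ha, hb, map_add]; simp only [smul_eq_mul]; ring
    | monomial n g =>
      rw [Polynomial.monomial_mul_monomial, partialLin_monomial, partialLin_monomial,
        partialLin_monomial, Derivation.leibniz]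
      simp only [← Polynomial.C_mul_X_pow_eq_monomial, smul_eq_mul, Polynomial.smul_eq_C_mul,
        map_mul]
      push_cast
      ring

/-- The differentiation `∂` of `Λ̄[x]`: the derivation over `ℂ` with `∂ x = x` and
`∂ (p l) = l x ^ l`. -/
def partialD : Derivation ℂ LambdaBar[X] LambdaBar[X] :=
  Derivation.mk' partialLin partialLin_mul

theorem partialD_X : partialD X = X := by
  change partialLin X = X
  rw [← Polynomial.monomial_one_one_eq_X, partialLin_monomial]
  simp [Polynomial.monomial_one_one_eq_X]

theorem partialD_p (l : ℕ) : partialD (C (p l)) = (l : LambdaBar[X]) * X ^ l := by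
  change partialLin (monomial 0 (p l)) = _
  rw [partialLin_monomial]
  simp [partialCoeff, p]

/-- `Δ(x ^ l)`: zero for `l = 0`, and
`x ^ l p₀ + 2 x ^ (l - 1) p₁ + ⋯ + 2 x p_{l-1} + p_l - 2 l x ^ l` for `l > 0`. -/
def deltaPow (l : ℕ) : LambdaBar[X] :=
  if l = 0 then 0
  else X ^ l * C (p 0) + 2 * ∑ i ∈ Finset.Ico 1 l, X ^ (l - i) * C (p i) + C (p l)
    - 2 * (l : LambdaBar[X]) * X ^ l

/-- The `Λ̄`-linear operator `Δ` on `Λ̄[x]`, `Δ(x ^ l f) = Δ(x ^ l) f` for `f ∈ Λ̄`. -/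
def delta : LambdaBar[X] →ₗ[LambdaBar] LambdaBar[X] :=
  Polynomial.lsum fun l => LinearMap.toSpanSingleton LambdaBar LambdaBar[X] (deltaPow l)

/-- The `Λ̄`-linear operator `E : Λ̄[x] → Λ̄`, `E(x ^ l f) = p_l f` for `f ∈ Λ̄`. -/
def E : LambdaBar[X] →ₗ[LambdaBar] LambdaBar :=
  Polynomial.lsum fun l => LinearMap.toSpanSingleton LambdaBar LambdaBar (p l)

/-- The infinite dimensional Dunkl–Heckman operator `D_k = ∂ - (1/2) k Δ` on `Λ̄[x]`. -/
def D (k : ℂ) : Module.End ℂ LambdaBar[X] :=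
  (partialD : LambdaBar[X] →ₗ[ℂ] LambdaBar[X]) - (1 / 2 * k) • delta.restrictScalars ℂ

/-- The operators `ℒ⁽ʳ⁾ = E ∘ D_k ^ r`, restricted to `Λ̄ ⊆ Λ̄[x]`. -/
def L (k : ℂ) (r : ℕ) : Module.End ℂ LambdaBar :=
  E.restrictScalars ℂ ∘ₗ (D k ^ r) ∘ₗ (Polynomial.CAlgHom (R := ℂ) (A := LambdaBar)).toLinearMap

/-- `∂_a = a ∂/∂p_a` on `Λ̄`. -/
def partialP (a : ℕ) (f : LambdaBar) : LambdaBar :=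
  (a : LambdaBar) * MvPolynomial.pderiv a f

/-- The trigonometric CMS operator at infinity,
`∑_{a,b>0} p_{a+b} ∂_a ∂_b - k ∑_{a,b>0} p_a p_b ∂_{a+b} + (1+k) ∑_{a>0} a p_a ∂_a
  - k p₀ ∑_{a>0} p_a ∂_a`.
Applied to any `f ∈ Λ̄`, each of the sums has only finitely many nonzero terms; see
`cms_finite₁`, …, `cms_finite₄`. -/
def cmsInfinity (k : ℂ) (f : LambdaBar) : LambdaBar :=
  (∑ᶠ ab : ℕ+ × ℕ+, p (ab.1 + ab.2) * partialP ab.1 (partialP ab.2 f))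
    - k • (∑ᶠ ab : ℕ+ × ℕ+, p ab.1 * p ab.2 * partialP (ab.1 + ab.2) f)
    + (1 + k) • (∑ᶠ a : ℕ+, ((a : ℕ) : LambdaBar) * p a * partialP a f)
    - k • (p 0 * ∑ᶠ a : ℕ+, p a * partialP a f)

theorem exists_partialP_eq_zero (f : LambdaBar) : ∃ n : ℕ, ∀ a, n < a → partialP a f = 0 := by
  refine ⟨f.vars.sup id, fun a ha => ?_⟩
  have h : a ∉ f.vars := fun h => absurd (Finset.le_sup (f := id) h) (not_le.mpr ha)
  simp [partialP, MvPolynomial.pderiv_eq_zero_of_notMem_vars h]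

theorem cms_finite₁ (f : LambdaBar) : (Function.support fun ab : ℕ+ × ℕ+ =>
    p (ab.1 + ab.2) * partialP ab.1 (partialP ab.2 f)).Finite := by
  obtain ⟨n, hn⟩ := exists_partialP_eq_zero f
  choose m hm using fun b : ℕ => exists_partialP_eq_zero (partialP b f)
  obtain ⟨M, hM⟩ : ∃ M, ∀ b ≤ n, m b ≤ M :=
    ⟨(Finset.range (n + 1)).sup m, fun b hb => Finset.le_sup (f := m) (by simpa using hb)⟩
  refine ((Set.finite_Iic (M.succPNat)).prod (Set.finite_Iic (n.succPNat))).subset ?_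
  rintro ⟨a, b⟩ hab
  have hb : (b : ℕ) ≤ n := by
    by_contra! h
    exact hab (by dsimp only; rw [hn _ h]; simp [partialP])
  have ha : (a : ℕ) ≤ M := by
    by_contra! h
    exact hab (by simp [hm _ _ ((hM _ hb).trans_lt h)])
  exact ⟨PNat.coe_le_coe _ _ |>.mp (by simp; omega), PNat.coe_le_coe _ _ |>.mp (by simp; omega)⟩

theorem cms_finite₂ (f : LambdaBar) : (Function.support fun ab : ℕ+ × ℕ+ =>
    p ab.1 * p ab.2 * partialP (ab.1 + ab.2) f).Finite := by
  obtain ⟨n, hn⟩ := exists_partialP_eq_zero f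
  refine ((Set.finite_Iic (n.succPNat)).prod (Set.finite_Iic (n.succPNat))).subset ?_
  rintro ⟨a, b⟩ hab
  have h : (a + b : ℕ) ≤ n := by
    by_contra! h
    exact hab (by simp [hn _ h])
  exact ⟨PNat.coe_le_coe _ _ |>.mp (by simp; omega), PNat.coe_le_coe _ _ |>.mp (by simp; omega)⟩

theorem cms_finite₃ (f : LambdaBar) : (Function.support fun a : ℕ+ =>
    ((a : ℕ) : LambdaBar) * p a * partialP a f).Finite := by
  obtain ⟨n, hn⟩ := exists_partialP_eq_zero f
  refine (Set.finite_Iic (n.succPNat)).subset fun a ha => ?_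
  have h : (a : ℕ) ≤ n := by
    by_contra! h
    exact ha (by simp [hn _ h])
  exact PNat.coe_le_coe _ _ |>.mp (by simp; omega)

theorem cms_finite₄ (f : LambdaBar) : (Function.support fun a : ℕ+ =>
    p a * partialP a f).Finite := by
  obtain ⟨n, hn⟩ := exists_partialP_eq_zero f
  refine (Set.finite_Iic (n.succPNat)).subset fun a ha => ?_
  have h : (a : ℕ) ≤ n := by
    by_contra! h
    exact ha (by simp [hn _ h])
  exact PNat.coe_le_coe _ _ |>.mp (by simp; omega)

end DunklHeckman

end

/-!
Specialising `p l` to the power sum `∑ xᵢ ^ l` in `n` variables turns `D k` into the `n`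
Dunkl–Heckman operators `Dᵢ` acting on rational functions, and `L k r` into the action of `∑ Dᵢ ^ r`
on symmetric ones. An element of `Λ̄` is determined by its specialisations for all large `n`, so it
is enough that these sums commute on symmetric functions.

The `Dᵢ` themselves do not commute, but `[Dᵢ, Dⱼ]` is a linear combination of differences `g - g⁻¹`
of permutations. Let `e` be the average over all permutations. For a word `w` in the `Dᵢ`, let `wᵒᵖ`
be the word read backwards, and suppose that `e u e = e uᵒᵖ e` for all shorter words `u`. Then
interchanging two neighbouring letters of `w` changes `e w e` and `e wᵒᵖ e` by the same amount. The
difference `e w e - e wᵒᵖ e` is therefore invariant under all permutations of the letters, in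
particular under the reversal, which negates it, and so it vanishes. For `w = Dᵢ ^ r Dⱼ ^ s` this is
the required commutation.
-/

noncomputable section

namespace DunklHeckman

section ReversibleWords

variable {R A ι G : Type*} [CommRing R] [Ring A] [Algebra R A] [Group G] [MulAction G ι]

/-- The word `D i₁ * ⋯ * D iₙ` spelled by the list `[i₁, …, iₙ]`. -/
def word (D : ι → A) (l : List ι) : A := (l.map D).prod

theorem word_append (D : ι → A) (l l' : List ι) : word D (l ++ l') = word D l * word D l' := by
  simp only [word, List.map_append, List.prod_append]

theorem word_cons (D : ι → A) (i : ι) (l : List ι) : word D (i :: l) = D i * word D l := by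
  simp only [word, List.map_cons, List.prod_cons]

theorem word_replicate (D : ι → A) (n : ℕ) (i : ι) : word D (List.replicate n i) = D i ^ n := by
  simp only [word, List.map_replicate, List.prod_replicate]

/-- A word is reversible between two copies of `e` if `e * - * e` does not distinguish it from the
word spelled backwards. -/
def IsReversible (D : ι → A) (e : A) (l : List ι) : Prop :=
  e * word D l * e = e * word D l.reverse * e

variable (R) in
/-- Elements `D i` of an `R`-algebra which a group permutes through `ρ` and whose commutators are
linear combinations of the differences `ρ g - ρ g⁻¹`. These relations are stable under the
anti-automorphism fixing every `D i` and inverting every `ρ g`. -/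
structure IsDunklFamily (ρ : G →* A) (D : ι → A) : Prop where
  semiconjBy : ∀ g i, SemiconjBy (ρ g) (D i) (D (g • i))
  lie_mem_span : ∀ i j, ⁅D i, D j⁆ ∈ Submodule.span R (Set.range fun g => ρ g - ρ g⁻¹)

namespace IsDunklFamily

variable {ρ : G →* A} {D : ι → A} {e : A}

theorem semiconjBy_word (h : IsDunklFamily R ρ D) (g : G) (l : List ι) :
    SemiconjBy (ρ g) (word D l) (word D (l.map (g • ·))) := by
  induction l with
  | nil => exact SemiconjBy.one_right _
  | cons i l ih =>
    rw [List.map_cons, word_cons, word_cons]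
    exact (h.semiconjBy g i).mul_right ih

theorem sandwich_move_right (h : IsDunklFamily R ρ D) (he : ∀ g, ρ g * e = e) (g : G)
    (u v : List ι) :
    e * (word D u * ρ g * word D v) * e = e * word D (u ++ v.map (g • ·)) * e := by
  calc e * (word D u * ρ g * word D v) * e = e * (word D u * (ρ g * word D v)) * e := by
        simp only [mul_assoc]
    _ = e * (word D u * word D (v.map (g • ·))) * (ρ g * e) := by
        rw [(h.semiconjBy_word g v).eq]; simp only [mul_assoc]
    _ = e * word D (u ++ v.map (g • ·)) * e := by rw [he, word_append]

theorem sandwich_move_left (h : IsDunklFamily R ρ D) (he : ∀ g, e * ρ g = e) (g : G)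
    (u v : List ι) :
    e * (word D (u.map (g • ·)) * ρ g * word D v) * e = e * word D (u ++ v) * e := by
  rw [← (h.semiconjBy_word g u).eq, mul_assoc (ρ g), ← mul_assoc e, he, word_append]

theorem sandwich_add_reverse_eq_zero (h : IsDunklFamily R ρ D) (hl : ∀ g, ρ g * e = e)
    (hr : ∀ g, e * ρ g = e) {u v : List ι}
    (huv : ∀ l : List ι, l.length = u.length + v.length → IsReversible D e l) {x : A}
    (hx : x ∈ Submodule.span R (Set.range fun g => ρ g - ρ g⁻¹)) :
    e * (word D u * x * word D v) * e + e * (word D v.reverse * x * word D u.reverse) * e = 0 := by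
  have moved (g : G) : e * (word D u * ρ g * word D v) * e
      = e * (word D v.reverse * ρ g⁻¹ * word D u.reverse) * e := by
    have hrev := huv (u ++ v.map (g • ·)) (by simp)
    have hv := h.sandwich_move_left hr g⁻¹ (v.reverse.map (g • ·)) u.reverse
    simp only [List.map_map, Function.comp_def, inv_smul_smul, List.map_id'] at hv
    rw [h.sandwich_move_right hl, hrev, hv, List.reverse_append, List.map_reverse]
  induction hx using Submodule.span_induction with
  | mem x hx =>
    obtain ⟨g, rfl⟩ := hx
    have hinv := moved g⁻¹
    rw [inv_inv] at hinv
    simp only [mul_sub, sub_mul, moved g, hinv]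
    abel
  | zero => simp only [mul_zero, zero_mul, add_zero]
  | add x y _ _ hx hy =>
    simp only [mul_add, add_mul]
    rw [add_add_add_comm, hx, hy, add_zero]
  | smul c x _ hx =>
    simp only [mul_smul_comm, smul_mul_assoc, ← smul_add, hx, smul_zero]

theorem reversal_defect_swap (h : IsDunklFamily R ρ D) (hl : ∀ g, ρ g * e = e)
    (hr : ∀ g, e * ρ g = e) {u v : List ι}
    (huv : ∀ l : List ι, l.length = u.length + v.length → IsReversible D e l) (i j : ι) :
    e * word D (u ++ i :: j :: v) * e - e * word D (u ++ i :: j :: v).reverse * e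
      = e * word D (u ++ j :: i :: v) * e - e * word D (u ++ j :: i :: v).reverse * e := by
  have hzero := h.sandwich_add_reverse_eq_zero hl hr huv (h.lie_mem_span i j)
  rw [← sub_eq_zero, ← hzero, Ring.lie_def]
  simp only [List.reverse_append, List.reverse_cons, List.append_assoc, List.cons_append,
    List.nil_append, word_append, word_cons]
  noncomm_ring

theorem reversal_defect_perm (h : IsDunklFamily R ρ D) (hl : ∀ g, ρ g * e = e)
    (hr : ∀ g, e * ρ g = e) {l l' : List ι} (hp : l.Perm l') (u : List ι)
    (hrev : ∀ w : List ι, w.length < (u ++ l).length → IsReversible D e w) :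
    e * word D (u ++ l) * e - e * word D (u ++ l).reverse * e
      = e * word D (u ++ l') * e - e * word D (u ++ l').reverse * e := by
  induction hp generalizing u with
  | nil => rfl
  | @cons i l l' _ ih =>
    rw [List.append_cons u i l] at hrev
    rw [List.append_cons u i l, List.append_cons u i l']
    exact ih _ hrev
  | swap i j l =>
    refine h.reversal_defect_swap hl hr (fun w hw => hrev w ?_) j i
    simp only [hw, List.length_append, List.length_cons]
    omega
  | trans h₁ _ ih₁ ih₂ =>
    refine (ih₁ u hrev).trans (ih₂ u fun w hw => hrev w ?_)
    simpa only [List.length_append, h₁.length_eq] using hw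

theorem isReversible [IsAddTorsionFree A] (h : IsDunklFamily R ρ D) (hl : ∀ g, ρ g * e = e)
    (hr : ∀ g, e * ρ g = e) (l : List ι) : IsReversible D e l := by
  induction hn : l.length using Nat.strong_induction_on generalizing l with
  | _ n ih =>
    have hdefect := h.reversal_defect_perm hl hr l.reverse_perm.symm []
      fun w hw => ih _ (hn ▸ hw) w rfl
    -- The reversed word is a permutation of the word, and its defect is the negative one.
    rw [List.nil_append, List.nil_append, List.reverse_reverse, ← neg_sub, neg_eq_self] at hdefect
    exact (sub_eq_zero.mp hdefect).symm

theorem sandwich_sum_pow_comm [IsAddTorsionFree A] [Fintype ι] (h : IsDunklFamily R ρ D)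
    (hl : ∀ g, ρ g * e = e) (hr : ∀ g, e * ρ g = e) (r s : ℕ) :
    e * ((∑ i, D i ^ r) * ∑ i, D i ^ s) * e = e * ((∑ i, D i ^ s) * ∑ i, D i ^ r) * e := by
  have hpow (i j : ι) : e * (D i ^ r * D j ^ s) * e = e * (D j ^ s * D i ^ r) * e := by
    have := h.isReversible hl hr (List.replicate r i ++ List.replicate s j)
    simpa only [IsReversible, List.reverse_append, List.reverse_replicate, word_append,
      word_replicate] using this
  simp only [Finset.mul_sum, Finset.sum_mul, hpow]
  exact Finset.sum_comm

theorem commute_sum_pow [Fintype ι] (h : IsDunklFamily R ρ D) (g : G) (r : ℕ) :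
    Commute (ρ g) (∑ i, D i ^ r) := by
  simp only [Commute, SemiconjBy, Finset.mul_sum, Finset.sum_mul,
    ((h.semiconjBy g _).pow_right r).eq]
  exact (MulAction.bijective g).sum_comp fun i => D i ^ r * ρ g

end IsDunklFamily

end ReversibleWords

section Invariants

theorem IsDunklFamily.sum_pow_comm_of_mem_invariants {R ι G V : Type*} [Field R] [CharZero R]
    [Group G] [Finite G] [MulAction G ι] [Fintype ι] [AddCommGroup V] [Module R V]
    {ρ : Representation R G V} {D : ι → Module.End R V} (h : IsDunklFamily R ρ D) (r s : ℕ) {v : V}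
    (hv : v ∈ ρ.invariants) :
    (∑ i, D i ^ r) ((∑ i, D i ^ s) v) = (∑ i, D i ^ s) ((∑ i, D i ^ r) v) := by
  have := Fintype.ofFinite G
  have := invertibleOfNonzero (Nat.cast_ne_zero (R := R).mpr (Fintype.card_ne_zero (α := G)))
  have : IsAddTorsionFree (Module.End R V) := .of_isTorsionFree R _
  have hl (g : G) : ρ g * ρ.averageMap = ρ.averageMap := LinearMap.ext fun w =>
    ρ.averageMap_invariant w g
  have hr (g : G) : ρ.averageMap * ρ g = ρ.averageMap := by
    rw [Representation.averageMap, ← ρ.asAlgebraHom_single_one, ← map_mul,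
      GroupAlgebra.mul_average_right]
  have hinv {w : V} (hw : w ∈ ρ.invariants) (t : ℕ) : (∑ i, D i ^ t) w ∈ ρ.invariants := fun g => by
    rw [← Module.End.mul_apply, (h.commute_sum_pow g t).eq, Module.End.mul_apply, hw g]
  have hcomm := DFunLike.congr_fun (h.sandwich_sum_pow_comm hl hr r s) v
  simpa only [Module.End.mul_apply, ρ.averageMap_id v hv, ρ.averageMap_id _ (hinv (hinv hv _) _)]
    using hcomm

end Invariants

section LieRing

theorem lie_sum_sum_of_antisymm {ι L : Type*} [Fintype ι] [LieRing L] {T : ι → ι → L}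
    (hdiag : ∀ i, T i i = 0) (hanti : ∀ i j, T j i = -T i j)
    (hdisj : ∀ {i j a b}, i ≠ j → a ≠ b → a ≠ j → b ≠ i → ⁅T i a, T j b⁆ = 0)
    {i j : ι} (hij : i ≠ j) :
    ⁅∑ a, T i a, ∑ b, T j b⁆
      = ∑ l, (⁅T i j, T j l⁆ + ⁅T i j, T i l⁆ + ⁅T i l, T j l⁆) := by
  classical
  have hterm (a b : ι) : ⁅T i a, T j b⁆ = (if a = j then ⁅T i j, T j b⁆ else 0)
      + (if b = i then ⁅T i j, T i a⁆ else 0) + (if a = b then ⁅T i a, T j a⁆ else 0) := by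
    rcases eq_or_ne a j with rfl | ha
    · rcases eq_or_ne b i with rfl | hb
      · simp [hanti b a, hij.symm]
      · simp +contextual [hb, hdiag]
    · rcases eq_or_ne b i with rfl | hb
      · rw [hanti b j, lie_neg, lie_skew]
        simp +contextual [ha, hdiag]
      · rcases eq_or_ne a b with rfl | hab
        · simp [ha, hb]
        · simp [ha, hb, hab, hdisj hij hab ha hb]
  calc ⁅∑ a, T i a, ∑ b, T j b⁆ = ∑ a, ∑ b, ⁅T i a, T j b⁆ := by rw [sum_lie_sum]
    _ = ∑ l, (⁅T i j, T j l⁆ + ⁅T i j, T i l⁆ + ⁅T i l, T j l⁆) := by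
      rw [Finset.sum_congr rfl fun a _ => Finset.sum_congr rfl fun b _ => hterm a b]
      simp only [Finset.sum_add_distrib, Finset.sum_ite_irrel, Finset.sum_ite_eq,
        Finset.sum_ite_eq', Finset.mem_univ, if_true, Finset.sum_const_zero]

end LieRing

section Derivation

theorem map_derivation_of_mem_adjoin {R A B : Type*} [CommRing R] [CommRing A] [CommRing B]
    [Algebra R A] [Algebra R B] (φ : A →ₐ[R] B) (d : Derivation R A A) (d' : Derivation R B B)
    {s : Set A} (hs : ∀ a ∈ s, φ (d a) = d' (φ a)) {a : A} (ha : a ∈ Algebra.adjoin R s) :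
    φ (d a) = d' (φ a) := by
  induction ha using Algebra.adjoin_induction with
  | mem a ha => exact hs a ha
  | algebraMap r => simp only [Derivation.map_algebraMap, AlgHom.commutes, map_zero]
  | add a b _ _ ha hb => simp only [map_add, ha, hb]
  | mul a b _ _ ha hb => simp only [Derivation.leibniz, map_add, map_mul, smul_eq_mul, ha, hb]

variable {R S : Type*} (T : Type*) [CommRing R] [CommRing S] [CommRing T] [Algebra R S]
  [Algebra R T] [Algebra S T] [IsScalarTower R S T] [Algebra.FormallyEtale S T]

/-- The unique extension of a derivation along a formally étale algebra, such as a localization. -/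
def extendDerivation (d : Derivation R S S) : Derivation R T T :=
  (((Algebra.linearMap S T).compDer d).liftKaehlerDifferential.liftBaseChange T ∘ₗ
    (KaehlerDifferential.tensorKaehlerEquivOfFormallyEtale R S T).symm.toLinearMap).compDer
    (KaehlerDifferential.D R T)

theorem extendDerivation_algebraMap (d : Derivation R S S) (s : S) :
    extendDerivation T d (algebraMap S T s) = algebraMap S T (d s) := by
  simp [extendDerivation, KaehlerDifferential.tensorKaehlerEquivOfFormallyEtale_symm_D_algebraMap]

end Derivation

section RationalFunctions

/-- The field of rational functions over `𝕜` in variables indexed by `ι`. -/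
abbrev RationalFunc (ι 𝕜 : Type*) [Field 𝕜] : Type _ := FractionRing (MvPolynomial ι 𝕜)

namespace RationalFunc

variable {ι : Type*} (𝕜 : Type*) [Field 𝕜]

/-- The coordinate functions in the field of rational functions. -/
def x (i : ι) : RationalFunc ι 𝕜 :=
  algebraMap (MvPolynomial ι 𝕜) (RationalFunc ι 𝕜) (.X i)

theorem x_injective : Function.Injective (x 𝕜 : ι → RationalFunc ι 𝕜) :=
  (IsFractionRing.injective (MvPolynomial ι 𝕜) _).comp (MvPolynomial.X_injective)

variable {𝕜}

theorem algebraMap_mem_adjoin_range_x (f : MvPolynomial ι 𝕜) :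
    algebraMap _ (RationalFunc ι 𝕜) f ∈ Algebra.adjoin 𝕜 (Set.range (x 𝕜)) := by
  have hf : f ∈ Algebra.adjoin 𝕜 (Set.range MvPolynomial.X) := by simp
  have hmap := Subalgebra.mem_map.mpr
    ⟨f, hf, IsScalarTower.toAlgHom_apply 𝕜 _ (RationalFunc ι 𝕜) f⟩
  rw [AlgHom.map_adjoin, ← Set.range_comp] at hmap
  exact hmap

theorem map_derivation_of_forall_x {κ : Type*} (σ : RationalFunc ι 𝕜 →ₐ[𝕜] RationalFunc κ 𝕜)
    {d : Derivation 𝕜 (RationalFunc ι 𝕜) (RationalFunc ι 𝕜)}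
    {d' : Derivation 𝕜 (RationalFunc κ 𝕜) (RationalFunc κ 𝕜)}
    (h : ∀ i, σ (d (x 𝕜 i)) = d' (σ (x 𝕜 i))) (f : RationalFunc ι 𝕜) : σ (d f) = d' (σ f) := by
  have hpoly (g : MvPolynomial ι 𝕜) : σ (d (algebraMap _ _ g)) = d' (σ (algebraMap _ _ g)) :=
    map_derivation_of_mem_adjoin σ d d' (Set.forall_mem_range.mpr h)
      (algebraMap_mem_adjoin_range_x g)
  obtain ⟨a, b, -, rfl⟩ := IsFractionRing.div_surjective (MvPolynomial ι 𝕜) f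
  simp only [Derivation.leibniz_div, smul_eq_mul, map_div₀, map_mul, map_sub, map_pow, map_inv₀,
    hpoly]

theorem derivation_ext {d d' : Derivation 𝕜 (RationalFunc ι 𝕜) (RationalFunc ι 𝕜)}
    (h : ∀ i, d (x 𝕜 i) = d' (x 𝕜 i)) : d = d' :=
  Derivation.ext (map_derivation_of_forall_x (.id 𝕜 (RationalFunc ι 𝕜)) h)

variable (𝕜)

/-- The action of permutations of the variables by field automorphisms. -/
def permAut : Equiv.Perm ι →* (RationalFunc ι 𝕜 ≃ₐ[𝕜] RationalFunc ι 𝕜) :=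
  (IsFractionRing.fieldEquivOfAlgEquivHom 𝕜 (RationalFunc ι 𝕜)).comp
    { toFun := MvPolynomial.renameEquiv 𝕜
      map_one' := MvPolynomial.renameEquiv_refl 𝕜
      map_mul' := fun v w => (MvPolynomial.renameEquiv_trans 𝕜 w v).symm }

/-- The action of permutations of the variables as a linear representation. -/
def permRep : Representation 𝕜 (Equiv.Perm ι) (RationalFunc ι 𝕜) :=
  (DistribMulAction.toModuleEnd 𝕜 (RationalFunc ι 𝕜)).comp (permAut 𝕜 (ι := ι))

/-- The Euler derivation `x i * ∂ / ∂ x i`. -/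
def euler (i : ι) : Derivation 𝕜 (RationalFunc ι 𝕜) (RationalFunc ι 𝕜) :=
  letI := Algebra.FormallyEtale.of_isLocalization (Rₘ := RationalFunc ι 𝕜)
    (nonZeroDivisors (MvPolynomial ι 𝕜))
  x 𝕜 i • extendDerivation (RationalFunc ι 𝕜) (MvPolynomial.pderiv i)

@[simp]
theorem permAut_x (w : Equiv.Perm ι) (i : ι) : permAut 𝕜 w (x 𝕜 i) = x 𝕜 (w i) := by
  simp [permAut, x]

theorem euler_x_self (i : ι) : euler 𝕜 i (x 𝕜 i) = x 𝕜 i := by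
  simp [euler, x, extendDerivation_algebraMap, Algebra.smul_def]

theorem euler_x_of_ne {i j : ι} (h : j ≠ i) : euler 𝕜 i (x 𝕜 j) = 0 := by
  simp [euler, x, extendDerivation_algebraMap, MvPolynomial.pderiv_X_of_ne h]

theorem euler_x_pow_self (i : ι) (l : ℕ) : euler 𝕜 i (x 𝕜 i ^ l) = l * x 𝕜 i ^ l := by
  rcases l with _ | l
  · simp
  · rw [Derivation.leibniz_pow, euler_x_self, Nat.add_sub_cancel, smul_eq_mul, ← pow_succ,
      nsmul_eq_mul]

theorem lie_euler (i j : ι) : ⁅euler 𝕜 i, euler 𝕜 j⁆ = 0 := by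
  refine derivation_ext fun l => ?_
  rcases eq_or_ne l i with rfl | hi <;> rcases eq_or_ne l j with rfl | hj <;>
    simp [Derivation.commutator_apply, euler_x_self, euler_x_of_ne, *]

variable {𝕜}

@[simp]
theorem permRep_apply (w : Equiv.Perm ι) (f : RationalFunc ι 𝕜) : permRep 𝕜 w f = permAut 𝕜 w f :=
  rfl

theorem permAut_permAut (v w : Equiv.Perm ι) (f : RationalFunc ι 𝕜) :
    permAut 𝕜 v (permAut 𝕜 w f) = permAut 𝕜 (v * w) f := by
  rw [map_mul, AlgEquiv.mul_apply]

theorem permAut_euler (w : Equiv.Perm ι) (i : ι) (f : RationalFunc ι 𝕜) :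
    permAut 𝕜 w (euler 𝕜 i f) = euler 𝕜 (w i) (permAut 𝕜 w f) := by
  refine map_derivation_of_forall_x (permAut 𝕜 w).toAlgHom (fun l => ?_) f
  rcases eq_or_ne l i with rfl | hi
  · simp [euler_x_self]
  · simp [euler_x_of_ne, hi]

end RationalFunc

end RationalFunctions

section Dunkl

namespace RationalFunc

section CothSub

variable {ι : Type*} (𝕜 : Type*) [Field 𝕜]

/-- `coth (zᵢ - zⱼ)` in the coordinates `xᵢ = exp (2 zᵢ)`. -/
def cothSub (i j : ι) : RationalFunc ι 𝕜 := (x 𝕜 i + x 𝕜 j) / (x 𝕜 i - x 𝕜 j)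

-- Division by zero makes the diagonal terms vanish, so that sums over `j ≠ i` need no restriction.
theorem cothSub_self (i : ι) : cothSub 𝕜 i i = 0 := by
  rw [cothSub, sub_self, div_zero]

theorem cothSub_swap (i j : ι) : cothSub 𝕜 j i = -cothSub 𝕜 i j := by
  rw [cothSub, cothSub, add_comm, ← neg_sub (x 𝕜 i), div_neg]

theorem cothSub_mul_add {i j l : ι} (hij : i ≠ j) (hjl : j ≠ l) (hil : i ≠ l) :
    cothSub 𝕜 i l * (cothSub 𝕜 i j + cothSub 𝕜 j l) = cothSub 𝕜 i j * cothSub 𝕜 j l + 1 := by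
  have hij := sub_ne_zero.mpr ((x_injective 𝕜).ne hij)
  have hjl := sub_ne_zero.mpr ((x_injective 𝕜).ne hjl)
  have hil := sub_ne_zero.mpr ((x_injective 𝕜).ne hil)
  simp only [cothSub]
  field_simp
  ring

@[simp]
theorem permAut_cothSub (w : Equiv.Perm ι) (i j : ι) :
    permAut 𝕜 w (cothSub 𝕜 i j) = cothSub 𝕜 (w i) (w j) := by
  simp only [cothSub, map_div₀, map_add, map_sub, permAut_x]

theorem euler_cothSub_of_ne {i j l : ι} (hi : l ≠ i) (hj : l ≠ j) :
    euler 𝕜 l (cothSub 𝕜 i j) = 0 := by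
  simp [cothSub, Derivation.leibniz_div, euler_x_of_ne 𝕜 hi.symm, euler_x_of_ne 𝕜 hj.symm]

theorem euler_add_euler_cothSub (i j : ι) :
    (euler 𝕜 i + euler 𝕜 j) (cothSub 𝕜 i j) = 0 := by
  rcases eq_or_ne i j with rfl | h
  · rw [cothSub_self, map_zero]
  · simp only [cothSub, Derivation.leibniz_div, Derivation.add_apply, map_add, map_sub,
      euler_x_self, euler_x_of_ne 𝕜 h, euler_x_of_ne 𝕜 h.symm, smul_eq_mul]
    ring

end CothSub

section DividedDiff

attribute [local instance] LieRing.ofAssociativeRing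

variable {ι : Type*} [DecidableEq ι] (𝕜 : Type*) [Field 𝕜]

/-- The operator `f ↦ (xᵢ + xⱼ) / (xᵢ - xⱼ) * (f - sᵢⱼ f)`, where `sᵢⱼ` exchanges `xᵢ` and `xⱼ`. -/
def dividedDiff (i j : ι) : Module.End 𝕜 (RationalFunc ι 𝕜) :=
  LinearMap.mulLeft 𝕜 (cothSub 𝕜 i j) * (1 - permRep 𝕜 (Equiv.swap i j))

variable {𝕜} in
theorem dividedDiff_apply (i j : ι) (f : RationalFunc ι 𝕜) :
    dividedDiff 𝕜 i j f = cothSub 𝕜 i j * (f - permAut 𝕜 (Equiv.swap i j) f) := rfl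

theorem dividedDiff_self (i : ι) : dividedDiff 𝕜 i i = 0 := by
  rw [dividedDiff, cothSub_self, LinearMap.mulLeft_zero_eq_zero, zero_mul]

theorem dividedDiff_swap (i j : ι) : dividedDiff 𝕜 j i = -dividedDiff 𝕜 i j := by
  ext f
  rw [LinearMap.neg_apply, dividedDiff_apply, dividedDiff_apply, cothSub_swap, Equiv.swap_comm,
    neg_mul]

variable {𝕜} in
theorem permAut_dividedDiff (w : Equiv.Perm ι) (i j : ι) (f : RationalFunc ι 𝕜) :
    permAut 𝕜 w (dividedDiff 𝕜 i j f) = dividedDiff 𝕜 (w i) (w j) (permAut 𝕜 w f) := by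
  have hswap : Equiv.swap (w i) (w j) * w = w * Equiv.swap i j := by
    rw [Equiv.swap_apply_apply, inv_mul_cancel_right]
  simp only [dividedDiff_apply, map_mul, map_sub, permAut_cothSub, permAut_permAut, hswap]

theorem lie_dividedDiff_of_disjoint {i j a b : ι} (hij : i ≠ j) (hab : a ≠ b) (haj : a ≠ j)
    (hbi : b ≠ i) : ⁅dividedDiff 𝕜 i a, dividedDiff 𝕜 j b⁆ = 0 := by
  ext f
  have hia := permAut_dividedDiff (Equiv.swap i a) j b f
  rw [Equiv.swap_apply_of_ne_of_ne hij.symm haj.symm, Equiv.swap_apply_of_ne_of_ne hbi hab.symm]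
    at hia
  have hcoth : permAut 𝕜 (Equiv.swap j b) (cothSub 𝕜 i a) = cothSub 𝕜 i a := by
    rw [permAut_cothSub, Equiv.swap_apply_of_ne_of_ne hij hbi.symm,
      Equiv.swap_apply_of_ne_of_ne haj hab]
  rw [Ring.lie_def, LinearMap.sub_apply, Module.End.mul_apply, Module.End.mul_apply,
    dividedDiff_apply i a, hia, dividedDiff_apply i a f]
  simp only [dividedDiff_apply, map_mul, map_sub, hcoth, LinearMap.zero_apply]
  ring

variable {𝕜} in
theorem dividedDiff_comp_apply (i j a b : ι) (f : RationalFunc ι 𝕜) :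
    dividedDiff 𝕜 i j (dividedDiff 𝕜 a b f)
      = cothSub 𝕜 i j * (cothSub 𝕜 a b * (f - permAut 𝕜 (Equiv.swap a b) f)
        - cothSub 𝕜 (Equiv.swap i j a) (Equiv.swap i j b)
          * (permAut 𝕜 (Equiv.swap i j) f - permAut 𝕜 (Equiv.swap i j * Equiv.swap a b) f)) := by
  simp only [dividedDiff_apply, map_sub, map_mul (permAut 𝕜 (Equiv.swap i j)), permAut_cothSub,
    permAut_permAut]

theorem lie_dividedDiff_cyclic {i j l : ι} (hij : i ≠ j) (hjl : j ≠ l) (hil : i ≠ l) :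
    ⁅dividedDiff 𝕜 i j, dividedDiff 𝕜 j l⁆ + ⁅dividedDiff 𝕜 i j, dividedDiff 𝕜 i l⁆
        + ⁅dividedDiff 𝕜 i l, dividedDiff 𝕜 j l⁆
      = permRep 𝕜 (Equiv.swap i j * Equiv.swap j l)
        - permRep 𝕜 (Equiv.swap i j * Equiv.swap j l)⁻¹ := by
  have hl : Equiv.swap i j l = l := Equiv.swap_apply_of_ne_of_ne hil.symm hjl.symm
  have hi : Equiv.swap j l i = i := Equiv.swap_apply_of_ne_of_ne hij hil
  have hj : Equiv.swap i l j = j := Equiv.swap_apply_of_ne_of_ne hij.symm hjl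
  have hrot₁ : Equiv.swap i l * Equiv.swap i j = Equiv.swap i j * Equiv.swap j l := by
    rw [Equiv.mul_swap_eq_swap_mul (Equiv.swap i j), Equiv.swap_apply_right, hl]
  have hrot₂ : Equiv.swap j l * Equiv.swap i l = Equiv.swap i j * Equiv.swap j l := by
    rw [Equiv.mul_swap_eq_swap_mul (Equiv.swap j l), Equiv.swap_apply_right, hi]
  have hrot₃ : Equiv.swap i j * Equiv.swap i l = Equiv.swap j l * Equiv.swap i j := by
    rw [Equiv.mul_swap_eq_swap_mul (Equiv.swap i j), Equiv.swap_apply_left, hl]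
  have hrot₄ : Equiv.swap i l * Equiv.swap j l = Equiv.swap j l * Equiv.swap i j := by
    rw [Equiv.mul_swap_eq_swap_mul (Equiv.swap j l), Equiv.swap_apply_left, hi]
  ext f
  simp only [Ring.lie_def, LinearMap.add_apply, LinearMap.sub_apply, Module.End.mul_apply,
    permRep_apply, dividedDiff_comp_apply, mul_inv_rev, Equiv.swap_inv, Equiv.swap_apply_left,
    Equiv.swap_apply_right, hl, hi, hj, hrot₁, hrot₂, hrot₃, hrot₄, cothSub_swap 𝕜 i j,
    cothSub_swap 𝕜 j l]
  linear_combination (permAut 𝕜 (Equiv.swap i j * Equiv.swap j l) f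
    - permAut 𝕜 (Equiv.swap j l * Equiv.swap i j) f) * cothSub_mul_add 𝕜 hij hjl hil

theorem lie_derivation_dividedDiff {d : Derivation 𝕜 (RationalFunc ι 𝕜) (RationalFunc ι 𝕜)}
    {i j : ι}
    (hcoth : d (cothSub 𝕜 i j) = 0)
    (hswap : ∀ f, permAut 𝕜 (Equiv.swap i j) (d f) = d (permAut 𝕜 (Equiv.swap i j) f)) :
    ⁅(d : Module.End 𝕜 (RationalFunc ι 𝕜)), dividedDiff 𝕜 i j⁆ = 0 := by
  ext f
  simp [Ring.lie_def, dividedDiff_apply, hcoth, hswap]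

theorem lie_euler_dividedDiff_of_ne {i j l : ι} (hi : l ≠ i) (hj : l ≠ j) :
    ⁅(euler 𝕜 l : Module.End 𝕜 (RationalFunc ι 𝕜)), dividedDiff 𝕜 i j⁆ = 0 :=
  lie_derivation_dividedDiff 𝕜 (euler_cothSub_of_ne 𝕜 hi hj) fun f => by
    rw [permAut_euler, Equiv.swap_apply_of_ne_of_ne hi hj]

theorem lie_euler_add_euler_dividedDiff (i j : ι) :
    ⁅((euler 𝕜 i + euler 𝕜 j : Derivation 𝕜 _ _) : Module.End 𝕜 (RationalFunc ι 𝕜)),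
      dividedDiff 𝕜 i j⁆ = 0 :=
  lie_derivation_dividedDiff 𝕜 (euler_add_euler_cothSub 𝕜 i j) fun f => by
    rw [Derivation.add_apply, map_add, permAut_euler, permAut_euler, Equiv.swap_apply_left,
      Equiv.swap_apply_right, Derivation.add_apply, add_comm]

variable [Fintype ι]

/-- The counterpart of `Δ` in finitely many variables: the sum of all `dividedDiff` at the `i`-th
variable. -/
def sumDividedDiff (i : ι) : Module.End 𝕜 (RationalFunc ι 𝕜) := ∑ j, dividedDiff 𝕜 i j

variable {𝕜} in
/-- The trigonometric Dunkl–Heckman operator in finitely many variables, with coupling `κ`. -/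
def dunkl (κ : 𝕜) (i : ι) : Module.End 𝕜 (RationalFunc ι 𝕜) :=
  (euler 𝕜 i : Module.End 𝕜 (RationalFunc ι 𝕜)) - κ • sumDividedDiff 𝕜 i

theorem lie_sumDividedDiff_mem_span {i j : ι} (hij : i ≠ j) :
    ⁅sumDividedDiff 𝕜 i, sumDividedDiff 𝕜 j⁆
      ∈ Submodule.span 𝕜 (Set.range fun w : Equiv.Perm ι => permRep 𝕜 w - permRep 𝕜 w⁻¹) := by
  rw [sumDividedDiff, sumDividedDiff, lie_sum_sum_of_antisymm (dividedDiff_self 𝕜)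
    (dividedDiff_swap 𝕜) (lie_dividedDiff_of_disjoint 𝕜) hij]
  refine Submodule.sum_mem _ fun l _ => ?_
  rcases eq_or_ne i l with rfl | hil
  · simp [dividedDiff_self, dividedDiff_swap 𝕜 i j]
  rcases eq_or_ne j l with rfl | hjl
  · simp [dividedDiff_self]
  · rw [lie_dividedDiff_cyclic 𝕜 hij hjl hil]
    exact Submodule.subset_span ⟨_, rfl⟩

theorem lie_euler_sumDividedDiff {i j : ι} (hij : i ≠ j) :
    ⁅(euler 𝕜 i : Module.End 𝕜 (RationalFunc ι 𝕜)), sumDividedDiff 𝕜 j⁆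
      = ⁅(euler 𝕜 i : Module.End 𝕜 (RationalFunc ι 𝕜)), dividedDiff 𝕜 j i⁆ := by
  rw [sumDividedDiff, lie_sum]
  refine Finset.sum_eq_single i (fun l _ hl => ?_) (by simp)
  exact lie_euler_dividedDiff_of_ne 𝕜 hij hl.symm

theorem lie_euler_sumDividedDiff_comm (i j : ι) :
    ⁅(euler 𝕜 i : Module.End 𝕜 (RationalFunc ι 𝕜)), sumDividedDiff 𝕜 j⁆
      = ⁅(euler 𝕜 j : Module.End 𝕜 (RationalFunc ι 𝕜)), sumDividedDiff 𝕜 i⁆ := by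
  rcases eq_or_ne i j with rfl | hij
  · rfl
  have h := lie_euler_add_euler_dividedDiff 𝕜 i j
  rw [Derivation.coe_add_linearMap, add_lie, add_eq_zero_iff_neg_eq] at h
  rw [lie_euler_sumDividedDiff 𝕜 hij, lie_euler_sumDividedDiff 𝕜 hij.symm, dividedDiff_swap,
    lie_neg, h]

variable {𝕜}

theorem lie_dunkl (κ : 𝕜) (i j : ι) :
    ⁅dunkl κ i, dunkl κ j⁆ = κ ^ 2 • ⁅sumDividedDiff 𝕜 i, sumDividedDiff 𝕜 j⁆ := by
  have heuler : ⁅(euler 𝕜 i : Module.End 𝕜 (RationalFunc ι 𝕜)),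
      (euler 𝕜 j : Module.End 𝕜 (RationalFunc ι 𝕜))⁆ = 0 := by
    rw [← Derivation.commutator_coe_linear_map, lie_euler, Derivation.coe_zero_linearMap]
  have hcomm := lie_euler_sumDividedDiff_comm 𝕜 i j
  simp only [Ring.lie_def] at heuler hcomm
  simp only [dunkl, Ring.lie_def, sub_mul, mul_sub, mul_smul_comm, smul_mul_assoc]
  linear_combination (norm := module) heuler - κ • hcomm

theorem isDunklFamily_dunkl (κ : 𝕜) :
    IsDunklFamily 𝕜 (permRep 𝕜 (ι := ι)) (dunkl κ) where
  semiconjBy w i := by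
    ext f
    have hsum : ∑ j, permAut 𝕜 w (dividedDiff 𝕜 i j f)
        = ∑ j, dividedDiff 𝕜 (w i) j (permAut 𝕜 w f) := by
      simp only [permAut_dividedDiff]
      exact Equiv.sum_comp w fun j => dividedDiff 𝕜 (w i) j (permAut 𝕜 w f)
    simp [dunkl, sumDividedDiff, permAut_euler, hsum]
  lie_mem_span i j := by
    rcases eq_or_ne i j with rfl | hij
    · simp
    · rw [lie_dunkl]
      exact Submodule.smul_mem _ _ (lie_sumDividedDiff_mem_span 𝕜 hij)

end DividedDiff

end RationalFunc

end Dunkl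

section Specialization

open RationalFunc

theorem sub_mul_sum_Ico_pow {R : Type*} [CommRing R] (a b : R) {l : ℕ} (hl : 1 ≤ l) :
    (a - b) * ∑ m ∈ Finset.Ico 1 l, a ^ (l - m) * b ^ m = a ^ l * b - a * b ^ l := by
  induction l, hl using Nat.le_induction with
  | base => simp
  | succ l hl ih =>
    have hterm : ∀ m ∈ Finset.Ico 1 l, a ^ (l + 1 - m) * b ^ m = a * (a ^ (l - m) * b ^ m) := by
      intro m hm
      rw [Nat.succ_sub (Finset.mem_Ico.mp hm).2.le, pow_succ', mul_assoc]
    rw [Finset.sum_Ico_succ_top hl, Finset.sum_congr rfl hterm, ← Finset.mul_sum,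
      Nat.add_sub_cancel_left, pow_one]
    linear_combination a * ih

theorem add_div_sub_mul_pow_sub_pow {K : Type*} [Field K] {a b : K} (hab : a ≠ b) {l : ℕ}
    (hl : 1 ≤ l) :
    (a + b) / (a - b) * (a ^ l - b ^ l)
      = a ^ l + b ^ l + 2 * ∑ m ∈ Finset.Ico 1 l, a ^ (l - m) * b ^ m := by
  rw [div_mul_eq_mul_div, div_eq_iff (sub_ne_zero.mpr hab)]
  linear_combination -2 * sub_mul_sum_Ico_pow a b hl

theorem dividedDiff_x_pow {ι : Type*} [DecidableEq ι] (i j : ι) {l : ℕ} (hl : 1 ≤ l) :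
    dividedDiff ℂ i j (x ℂ i ^ l)
      = (x ℂ i ^ l + x ℂ j ^ l + 2 * ∑ m ∈ Finset.Ico 1 l, x ℂ i ^ (l - m) * x ℂ j ^ m)
        - if j = i then 2 * l * x ℂ i ^ l else 0 := by
  rcases eq_or_ne j i with rfl | hj
  · have hterm : ∀ m ∈ Finset.Ico 1 l, x ℂ j ^ (l - m) * x ℂ j ^ m = x ℂ j ^ l := fun m hm =>
      pow_sub_mul_pow _ (Finset.mem_Ico.mp hm).2.le
    rw [dividedDiff_self, Finset.sum_congr rfl hterm, Finset.sum_const, Nat.card_Ico, if_pos rfl,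
      nsmul_eq_mul, Nat.cast_pred hl, LinearMap.zero_apply]
    ring
  · rw [dividedDiff_apply, map_pow, permAut_x, Equiv.swap_apply_left, cothSub,
      add_div_sub_mul_pow_sub_pow ((x_injective ℂ).ne hj.symm) hl, if_neg hj, sub_zero]

variable {ι : Type*} [Fintype ι]

variable (ι) in
/-- The specialization of `Λ̄` at finitely many variables: `p l` becomes the power sum `∑ xᵢ ^ l`,
and in particular `p 0` becomes the number of variables. -/
def powerSums : LambdaBar →ₐ[ℂ] RationalFunc ι ℂ :=
  MvPolynomial.aeval fun l => ∑ i, x ℂ i ^ l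

theorem powerSums_p (l : ℕ) : powerSums ι (p l) = ∑ i, x ℂ i ^ l := MvPolynomial.aeval_X ..

theorem permAut_powerSums (w : Equiv.Perm ι) (f : LambdaBar) :
    permAut ℂ w (powerSums ι f) = powerSums ι f := by
  have h : ((permAut ℂ w).toAlgHom.comp (powerSums ι)) = powerSums ι := by
    refine MvPolynomial.algHom_ext fun l => ?_
    simp only [AlgHom.comp_apply, powerSums_p, AlgEquiv.toAlgHom_apply, map_sum, map_pow, permAut_x]
    exact Equiv.sum_comp w fun i => x ℂ i ^ l
  exact DFunLike.congr_fun h f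

/-- The specialization of `Λ̄[x]` at finitely many variables extending `powerSums`, with the free
variable `x` equal to the `i`-th one. -/
def evalAt (i : ι) : LambdaBar[X] →ₐ[ℂ] RationalFunc ι ℂ :=
  Polynomial.eval₂AlgHom (powerSums ι) (x ℂ i) fun _ => Commute.all _ _

theorem evalAt_C (i : ι) (f : LambdaBar) : evalAt i (C f) = powerSums ι f := eval₂_C ..

theorem evalAt_X (i : ι) : evalAt i X = x ℂ i := eval₂_X ..

theorem evalAt_monomial (i : ι) (l : ℕ) (f : LambdaBar) :
    evalAt i (monomial l f) = powerSums ι f * x ℂ i ^ l := eval₂_monomial ..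

theorem E_monomial (l : ℕ) (f : LambdaBar) : E (monomial l f) = f * p l := by
  simp [E, lsum_apply, sum_monomial_index]

theorem powerSums_E (g : LambdaBar[X]) : powerSums ι (E g) = ∑ i, evalAt i g := by
  induction g using Polynomial.induction_on' with
  | add a b ha hb => simp only [map_add, ha, hb, Finset.sum_add_distrib]
  | monomial l f =>
    simp only [E_monomial, map_mul, powerSums_p, evalAt_monomial, Finset.mul_sum]

theorem adjoin_X_C_p : Algebra.adjoin ℂ (insert X (Set.range fun l => C (p l)))
    = (⊤ : Subalgebra ℂ LambdaBar[X]) := by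
  have hC (f : LambdaBar) : C f ∈ Algebra.adjoin ℂ (insert X (Set.range fun l => C (p l))) := by
    have hf : f ∈ Algebra.adjoin ℂ (Set.range MvPolynomial.X) := by simp
    have hmap := Subalgebra.mem_map.mpr ⟨f, hf, CAlgHom_apply (R := ℂ) f⟩
    rw [AlgHom.map_adjoin, ← Set.range_comp] at hmap
    exact Algebra.adjoin_mono (Set.subset_insert _ _) hmap
  refine eq_top_iff.mpr fun g _ => ?_
  induction g using Polynomial.induction_on' with
  | add a b ha hb => exact add_mem (ha trivial) (hb trivial)
  | monomial l f =>
    rw [← C_mul_X_pow_eq_monomial]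
    exact mul_mem (hC f) (pow_mem (Algebra.subset_adjoin (Set.mem_insert _ _)) l)

theorem evalAt_partialD (i : ι) (g : LambdaBar[X]) :
    evalAt i (partialD g) = euler ℂ i (evalAt i g) := by
  classical
  refine map_derivation_of_mem_adjoin (evalAt i) partialD (euler ℂ i)
    (s := insert X (Set.range fun l => C (p l))) ?_ (adjoin_X_C_p ▸ Algebra.mem_top)
  rintro _ (rfl | ⟨l, rfl⟩)
  · rw [partialD_X, evalAt_X, euler_x_self]
  · have hterm (j : ι) : euler ℂ i (x ℂ j ^ l) = if j = i then l * x ℂ i ^ l else 0 := by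
      rcases eq_or_ne j i with rfl | hj
      · rw [euler_x_pow_self, if_pos rfl]
      · simp [Derivation.leibniz_pow, euler_x_of_ne ℂ hj, hj]
    simp only [partialD_p, evalAt_C, powerSums_p, map_sum, hterm, map_mul, map_pow, map_natCast,
      evalAt_X, Finset.sum_ite_eq', Finset.mem_univ, if_true]

section Intertwining

variable [DecidableEq ι]

theorem dividedDiff_powerSums_mul (i j : ι) (f : LambdaBar) (g : RationalFunc ι ℂ) :
    dividedDiff ℂ i j (powerSums ι f * g) = powerSums ι f * dividedDiff ℂ i j g := by
  simp only [dividedDiff_apply, map_mul, permAut_powerSums]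
  ring

theorem sumDividedDiff_x_pow (i : ι) (l : ℕ) :
    sumDividedDiff ℂ i (x ℂ i ^ l) = evalAt i (deltaPow l) := by
  rcases Nat.eq_zero_or_pos l with rfl | hl
  · simp [deltaPow, sumDividedDiff, dividedDiff_apply]
  · simp only [sumDividedDiff, LinearMap.sum_apply, dividedDiff_x_pow _ _ hl,
      Finset.sum_sub_distrib, Finset.sum_add_distrib, ← Finset.mul_sum, Finset.sum_ite_eq',
      Finset.mem_univ, if_true, deltaPow, hl.ne', if_false, map_sub, map_add, map_mul, map_sum,
      map_pow, map_natCast, map_ofNat, evalAt_X, evalAt_C, powerSums_p, pow_zero]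
    rw [Finset.sum_comm]
    simp only [← Finset.mul_sum, Finset.sum_const, Finset.card_univ, nsmul_eq_mul]
    ring

theorem delta_monomial (l : ℕ) (f : LambdaBar) : delta (monomial l f) = C f * deltaPow l := by
  simp [delta, lsum_apply, sum_monomial_index, smul_eq_C_mul]

theorem evalAt_delta (i : ι) (g : LambdaBar[X]) :
    evalAt i (delta g) = sumDividedDiff ℂ i (evalAt i g) := by
  induction g using Polynomial.induction_on' with
  | add a b ha hb => simp only [map_add, ha, hb]
  | monomial l f =>
    rw [delta_monomial, map_mul, evalAt_C, evalAt_monomial, ← sumDividedDiff_x_pow]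
    simp only [sumDividedDiff, LinearMap.sum_apply, dividedDiff_powerSums_mul, Finset.mul_sum]

theorem evalAt_D (k : ℂ) (i : ι) (g : LambdaBar[X]) :
    evalAt i (D k g) = dunkl (1 / 2 * k) i (evalAt i g) := by
  simp only [D, dunkl, LinearMap.sub_apply, LinearMap.smul_apply, LinearMap.restrictScalars_apply,
    Derivation.coeFn_coe, map_sub, map_smul, evalAt_partialD, evalAt_delta]

theorem evalAt_D_pow (k : ℂ) (i : ι) (r : ℕ) (g : LambdaBar[X]) :
    evalAt i ((D k ^ r) g) = (dunkl (1 / 2 * k) i ^ r) (evalAt i g) := by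
  induction r with
  | zero => rfl
  | succ r ih => rw [pow_succ', pow_succ', Module.End.mul_apply, Module.End.mul_apply, evalAt_D, ih]

theorem powerSums_L (k : ℂ) (r : ℕ) (f : LambdaBar) :
    powerSums ι (L k r f) = (∑ i, dunkl (1 / 2 * k) i ^ r : Module.End ℂ _) (powerSums ι f) := by
  rw [L, LinearMap.comp_apply, LinearMap.comp_apply, LinearMap.restrictScalars_apply, powerSums_E,
    LinearMap.sum_apply]
  simp only [evalAt_D_pow, AlgHom.toLinearMap_apply, CAlgHom_apply, evalAt_C]

end Intertwining

theorem powerSums_L_comm (k : ℂ) (r s : ℕ) (f : LambdaBar) :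
    powerSums ι (L k r (L k s f)) = powerSums ι (L k s (L k r f)) := by
  classical
  simp only [powerSums_L]
  exact (isDunklFamily_dunkl (1 / 2 * k)).sum_pow_comm_of_mem_invariants r s
    fun w => permAut_powerSums w f

end Specialization

section Injectivity

section PDeriv

variable {σ R : Type*} [CommSemiring R]

theorem totalDegree_pderiv_lt {f : MvPolynomial σ R} {i : σ} (hi : i ∈ f.vars) :
    (MvPolynomial.pderiv i f).totalDegree < f.totalDegree := by
  classical
  have hpos : 0 < f.totalDegree := by
    obtain ⟨m, hm, him⟩ := (MvPolynomial.mem_vars_iff_mem_support i).mp hi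
    refine lt_of_lt_of_le ?_ (MvPolynomial.le_totalDegree hm)
    exact Finset.sum_pos (fun j hj => Nat.pos_of_ne_zero (Finsupp.mem_support_iff.mp hj)) ⟨i, him⟩
  refine (Finset.sup_lt_iff hpos).mpr fun m hm => ?_
  rw [MvPolynomial.mem_support_iff, MvPolynomial.coeff_pderiv] at hm
  have hle := MvPolynomial.le_totalDegree
    (MvPolynomial.mem_support_iff.mpr (left_ne_zero_of_mul hm))
  rw [Finsupp.sum_add_index' (fun _ => rfl) (fun _ _ _ => rfl), Finsupp.sum_single_index rfl] at hle
  exact hle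

theorem notMem_vars_of_pderiv_eq_zero [NoZeroDivisors R] [CharZero R] {f : MvPolynomial σ R} {i : σ}
    (h : MvPolynomial.pderiv i f = 0) : i ∉ f.vars := by
  intro hi
  obtain ⟨m, hm, him⟩ := (MvPolynomial.mem_vars_iff_mem_support i).mp hi
  have hle : Finsupp.single i 1 ≤ m :=
    Finsupp.single_le_iff.mpr (Nat.one_le_iff_ne_zero.mpr (Finsupp.mem_support_iff.mp him))
  have hcoeff := MvPolynomial.coeff_pderiv f (i := i) (m - Finsupp.single i 1)
  rw [h, tsub_add_cancel_of_le hle, MvPolynomial.coeff_zero, eq_comm] at hcoeff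
  exact mul_ne_zero (MvPolynomial.mem_support_iff.mp hm) (Nat.cast_add_one_ne_zero _) hcoeff

theorem induction_on_pderiv {P : MvPolynomial σ R → Prop}
    (h : ∀ f, (∀ i ∈ f.vars, P (MvPolynomial.pderiv i f)) → P f) (f : MvPolynomial σ R) : P f := by
  induction hd : f.totalDegree using Nat.strong_induction_on generalizing f with
  | _ d ih => exact h f fun i hi => ih _ (hd ▸ totalDegree_pderiv_lt hi) _ rfl

end PDeriv

theorem partialCoeff_p (m : ℕ) : partialCoeff (p m) = monomial m (m : LambdaBar) := by
  rw [partialCoeff, MvPolynomial.mkDerivation_X, ← C_eq_natCast, C_mul_X_pow_eq_monomial]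

theorem coeff_partialCoeff (f : LambdaBar) (l : ℕ) : (partialCoeff f).coeff l = partialP l f := by
  have h : (lcoeff LambdaBar l).compDer partialCoeff = (l : LambdaBar) • MvPolynomial.pderiv l := by
    refine MvPolynomial.derivation_ext fun m => ?_
    change (partialCoeff (p m)).coeff l = (l : LambdaBar) * MvPolynomial.pderiv l (p m)
    rw [partialCoeff_p, coeff_monomial]
    rcases eq_or_ne m l with rfl | hm
    · rw [if_pos rfl, MvPolynomial.pderiv_X_self, mul_one]
    · rw [if_neg hm, MvPolynomial.pderiv_X_of_ne hm, mul_zero]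
  exact DFunLike.congr_fun h f

theorem partialD_C (f : LambdaBar) : partialD (C f) = partialCoeff f :=
  (partialLin_monomial 0 f).trans (by simp)

theorem powerSums_partialP_eq_zero {ι : Type*} [Fintype ι] {f : LambdaBar}
    (hf : powerSums ι f = 0) (hcard : (partialCoeff f).natDegree < Fintype.card ι) (l : ℕ) :
    powerSums ι (partialP l f) = 0 := by
  classical
  have hmap : (partialCoeff f).map (powerSums ι : LambdaBar →+* RationalFunc ι ℂ) = 0 := by
    refine eq_zero_of_natDegree_lt_card_of_eval_eq_zero _ (RationalFunc.x_injective ℂ) (fun i => ?_)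
      (natDegree_map_le.trans_lt hcard)
    rw [eval_map]
    change evalAt i (partialCoeff f) = 0
    rw [← partialD_C, evalAt_partialD, evalAt_C, hf, map_zero]
  have hcoeff := coeff_map (powerSums ι : LambdaBar →+* RationalFunc ι ℂ) l (p := partialCoeff f)
  rw [hmap, coeff_zero, coeff_partialCoeff] at hcoeff
  exact hcoeff.symm

theorem exists_aeval_p_zero_eq {f : LambdaBar} (hf : ∀ l ∈ f.vars, l = 0) :
    ∃ q : ℂ[X], aeval (p 0) q = f := by
  have hmem : f ∈ MvPolynomial.supported ℂ {0} := MvPolynomial.mem_supported.mpr hf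
  rwa [MvPolynomial.supported_eq_adjoin_X, Set.image_singleton,
    Algebra.adjoin_singleton_eq_range_aeval] at hmem

theorem powerSums_aeval_p_zero {ι : Type*} [Fintype ι] (q : ℂ[X]) :
    powerSums ι (aeval (p 0) q) = algebraMap ℂ _ (q.eval (Fintype.card ι : ℂ)) := by
  have hcard : powerSums ι (p 0) = algebraMap ℂ _ (Fintype.card ι : ℂ) := by
    simp [powerSums_p]
  rw [← aeval_algHom_apply, hcard, aeval_algebraMap_apply, coe_aeval_eq_eval]

theorem eq_zero_of_eventually_powerSums_eq_zero {f : LambdaBar}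
    (hf : ∀ᶠ n in Filter.atTop, powerSums (Fin n) f = 0) : f = 0 := by
  induction f using induction_on_pderiv with
  | h f ih =>
  have hvars : ∀ l ∈ f.vars, l = 0 := by
    intro l hl
    by_contra hl0
    refine notMem_vars_of_pderiv_eq_zero (ih l hl ?_) hl
    filter_upwards [hf, Filter.eventually_gt_atTop (partialCoeff f).natDegree] with n hn hdeg
    have hpartial := powerSums_partialP_eq_zero hn (hdeg.trans_eq (Fintype.card_fin n).symm) l
    rw [partialP, map_mul, map_natCast] at hpartial
    exact (mul_eq_zero.mp hpartial).resolve_left (Nat.cast_ne_zero.mpr hl0)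
  obtain ⟨q, rfl⟩ := exists_aeval_p_zero_eq hvars
  have hroot : ∀ᶠ n : ℕ in Filter.atTop, q.eval (n : ℂ) = 0 := by
    filter_upwards [hf] with n hn
    rwa [powerSums_aeval_p_zero, Fintype.card_fin, map_eq_zero] at hn
  have hinf : {n : ℕ | q.eval (n : ℂ) = 0}.Infinite :=
    Nat.frequently_atTop_iff_infinite.mp hroot.frequently
  have hq : q = 0 := by
    refine eq_zero_of_infinite_isRoot q ((hinf.image Nat.cast_injective.injOn).mono ?_)
    exact Set.image_subset_iff.mpr fun n hn => hn
  rw [hq, map_zero]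

theorem L_commute (k : ℂ) (r s : ℕ) : ⁅L k r, L k s⁆ = 0 := by
  refine LinearMap.ext fun f => ?_
  refine eq_zero_of_eventually_powerSums_eq_zero (.of_forall fun n => ?_)
  rw [Ring.lie_def, LinearMap.sub_apply, map_sub, sub_eq_zero]
  exact powerSums_L_comm k r s f

end Injectivity

section SecondOperator

theorem sum_Ico_pnat_coe {M : Type*} [AddCommMonoid M] (F : ℕ → M) (l m : ℕ+) :
    ∑ i ∈ Finset.Ico l m, F i = ∑ i ∈ Finset.Ico (l : ℕ) m, F i :=
  (Finset.sum_map _ _ F).symm.trans <|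
    congrArg (fun s => ∑ i ∈ s, F i) (PNat.map_subtype_embedding_Ico l m)

theorem finsum_pnat_prod_eq_finsum_sum_Ico {M : Type*} [AddCommMonoid M] (F : ℕ → ℕ → M)
    (hF : (Function.support fun ab : ℕ+ × ℕ+ => F ab.1 ab.2).Finite) :
    ∑ᶠ ab : ℕ+ × ℕ+, F ab.1 ab.2 = ∑ᶠ l : ℕ+, ∑ i ∈ Finset.Ico 1 (l : ℕ), F (l - i) i := by
  let shear : ℕ+ × ℕ+ → ℕ+ × ℕ+ := fun ab => (ab.1 + ab.2, ab.2)
  let G : ℕ+ × ℕ+ → M := fun li => if li.2 < li.1 then F (li.1 - li.2) li.2 else 0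
  have shear_injective : shear.Injective := by
    rintro ⟨a, b⟩ ⟨c, d⟩ h
    obtain ⟨h₁, rfl : b = d⟩ := Prod.mk.inj h
    exact congrArg (·, b) (add_right_cancel h₁)
  have G_shear (ab : ℕ+ × ℕ+) : G (shear ab) = F ab.1 ab.2 := by
    simp [G, shear, PNat.lt_add_left]
  have support_G : G.support = shear '' Function.support fun ab : ℕ+ × ℕ+ => F ab.1 ab.2 := by
    simp only [← G_shear]
    refine (Set.image_preimage_eq_of_subset fun ⟨l, i⟩ hli => ⟨(l - i, i), ?_⟩).symm
    have hil : i < l := (ite_ne_right_iff.mp hli).1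
    simp [shear, add_comm, PNat.add_sub_of_lt hil]
  have finite_support_G : G.support.Finite := support_G ▸ hF.image shear
  calc ∑ᶠ ab : ℕ+ × ℕ+, F ab.1 ab.2
    _ = ∑ᶠ li, G li := by
        rw [← finsum_mem_support G, support_G, finsum_mem_image shear_injective.injOn]
        simp only [G_shear, finsum_mem_support]
    _ = ∑ᶠ (l) (i), G (l, i) := finsum_curry G finite_support_G
    _ = ∑ᶠ l : ℕ+, ∑ i ∈ Finset.Ico 1 (l : ℕ), F (l - i) i := by
        refine finsum_congr fun l => ?_
        rw [← PNat.one_coe, ← sum_Ico_pnat_coe (fun i => F (l - i) i),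
          finsum_eq_sum_of_support_subset (s := Finset.Ico 1 l)]
        · exact Finset.sum_congr rfl fun i hi => if_pos (Finset.mem_Ico.mp hi).2
        · intro i hi
          exact Finset.mem_Ico.mpr ⟨one_le, (ite_ne_right_iff.mp hi).1⟩

theorem finite_support_partialP {M : Type*} [Zero M] {F : ℕ+ → LambdaBar → M}
    (hF : ∀ a, F a 0 = 0) (f : LambdaBar) :
    (Function.support fun a => F a (partialP a f)).Finite := by
  obtain ⟨n, hn⟩ := exists_partialP_eq_zero f
  refine ((Set.finite_Iic n).preimage PNat.coe_injective.injOn).subset fun a ha => ?_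
  by_contra h
  exact ha ((congrArg (F a) (hn a (not_le.mp h))).trans (hF a))

theorem partialCoeff_eq_finsum (f : LambdaBar) :
    partialCoeff f = ∑ᶠ a : ℕ+, monomial a (partialP a f) := by
  ext1 l
  have hfin := finite_support_partialP (fun a => map_zero (monomial a)) f
  have hcoeff := (lcoeff LambdaBar l).toAddMonoidHom.map_finsum hfin
  simp only [LinearMap.toAddMonoidHom_coe, lcoeff_apply, coeff_monomial] at hcoeff
  rw [hcoeff, coeff_partialCoeff]
  rcases Nat.eq_zero_or_pos l with rfl | hl
  · simp [partialP]
  · lift l to ℕ+ using hl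
    rw [finsum_eq_single _ l fun a ha => if_neg fun h => ha (PNat.eq h), if_pos rfl]

theorem map_partialCoeff {M : Type*} [AddCommMonoid M] (φ : LambdaBar[X] →+ M) (f : LambdaBar) :
    φ (partialCoeff f) = ∑ᶠ a : ℕ+, φ (monomial a (partialP a f)) := by
  rw [partialCoeff_eq_finsum,
    φ.map_finsum (finite_support_partialP (fun a => map_zero (monomial a)) f)]

theorem partialD_monomial (l : ℕ) (f : LambdaBar) :
    partialD (monomial l f) = monomial l (l * f) + X ^ l * partialCoeff f := by
  refine (partialLin_monomial l f).trans ?_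
  rw [← C_mul_X_pow_eq_monomial, C_mul, C_eq_natCast]
  ring

theorem E_partialD_monomial (l : ℕ) (f : LambdaBar) : E (partialD (monomial l f)) =
    l * p l * f + ∑ᶠ a : ℕ+, p (a + l) * partialP a f := by
  have h := map_partialCoeff (E.toAddMonoidHom.comp (AddMonoidHom.mulLeft (X ^ l))) f
  simp only [AddMonoidHom.comp_apply, AddMonoidHom.coe_mulLeft, LinearMap.toAddMonoidHom_coe,
    X_pow_mul_monomial, E_monomial, mul_comm (partialP _ f)] at h
  rw [partialD_monomial, map_add, h, E_monomial, mul_right_comm]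

theorem E_partialD_partialCoeff (f : LambdaBar) : E (partialD (partialCoeff f)) =
    (∑ᶠ a : ℕ+, ((a : ℕ) : LambdaBar) * p a * partialP a f) +
      ∑ᶠ ab : ℕ+ × ℕ+, p (ab.1 + ab.2) * partialP ab.1 (partialP ab.2 f) := by
  have hswap : (Function.support fun ba : ℕ+ × ℕ+ =>
      p (ba.2 + ba.1) * partialP ba.2 (partialP ba.1 f)).Finite :=
    (cms_finite₁ f).preimage Prod.swap_injective.injOn
  have hinner : (Function.support fun b : ℕ+ =>
      ∑ᶠ a : ℕ+, p (a + b) * partialP a (partialP b f)).Finite :=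
    finite_support_partialP (F := fun b g => ∑ᶠ a : ℕ+, p (a + b) * partialP a g)
      (by simp [partialP]) f
  calc E (partialD (partialCoeff f))
    _ = ∑ᶠ b : ℕ+, E (partialD (monomial b (partialP b f))) :=
        map_partialCoeff
          (E.toAddMonoidHom.comp (partialD : LambdaBar[X] →ₗ[ℂ] LambdaBar[X]).toAddMonoidHom) f
    _ = (∑ᶠ b : ℕ+, ((b : ℕ) : LambdaBar) * p b * partialP b f) +
          ∑ᶠ (b : ℕ+) (a : ℕ+), p (a + b) * partialP a (partialP b f) := by
        simp only [E_partialD_monomial, finsum_add_distrib (cms_finite₃ f) hinner]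
    _ = _ := by
        rw [← finsum_comp_equiv (Equiv.prodComm ℕ+ ℕ+)]
        exact congrArg _ (finsum_curry _ hswap).symm

theorem E_deltaPow (l : ℕ+) : E (deltaPow l) =
    2 * (p 0 * p l + ∑ i ∈ Finset.Ico 1 (l : ℕ), p (l - i) * p i - (l : ℕ) * p l) := by
  have hdelta : deltaPow l = monomial l (p 0)
      + (2 : LambdaBar) • ∑ i ∈ Finset.Ico 1 (l : ℕ), monomial (l - i) (p i)
      + monomial 0 (p l) - (2 : LambdaBar) • monomial l ((l : ℕ) : LambdaBar) := by
    simp only [deltaPow, if_neg l.ne_zero, ← C_mul_X_pow_eq_monomial, X_pow_mul_C, smul_eq_C_mul,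
      C_ofNat, C_eq_natCast, pow_zero, mul_one, mul_assoc]
  rw [hdelta]
  simp only [map_sub, map_add, map_smul, map_sum, E_monomial, smul_eq_mul,
    mul_comm (p _) (p (_ - _))]
  ring

theorem E_delta_monomial (l : ℕ+) (f : LambdaBar) : E (delta (monomial l f)) =
    2 * (p 0 * (p l * f) + ∑ i ∈ Finset.Ico 1 (l : ℕ), p (l - i) * p i * f
      - (l : ℕ) * p l * f) := by
  rw [delta_monomial, ← smul_eq_C_mul, map_smul, E_deltaPow, smul_eq_mul, ← Finset.sum_mul]
  ring

theorem E_delta_partialCoeff (f : LambdaBar) : E (delta (partialCoeff f)) =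
    2 * (p 0 * (∑ᶠ a : ℕ+, p a * partialP a f) +
      (∑ᶠ ab : ℕ+ × ℕ+, p ab.1 * p ab.2 * partialP (ab.1 + ab.2) f) -
      ∑ᶠ a : ℕ+, ((a : ℕ) : LambdaBar) * p a * partialP a f) := by
  have hmid : (Function.support fun l : ℕ+ =>
      ∑ i ∈ Finset.Ico 1 (l : ℕ), p (l - i) * p i * partialP l f).Finite :=
    finite_support_partialP (F := fun l g => ∑ i ∈ Finset.Ico 1 (l : ℕ), p (l - i) * p i * g)
      (by simp) f
  have hlead : (Function.support fun l : ℕ+ => p 0 * (p l * partialP l f)).Finite :=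
    finite_support_partialP (F := fun l g => p 0 * (p l * g)) (by simp) f
  have hreindex : ∑ᶠ ab : ℕ+ × ℕ+, p ab.1 * p ab.2 * partialP (ab.1 + ab.2) f =
      ∑ᶠ l : ℕ+, ∑ i ∈ Finset.Ico 1 (l : ℕ), p (l - i) * p i * partialP l f := by
    rw [finsum_pnat_prod_eq_finsum_sum_Ico (fun a b => p a * p b * partialP (a + b) f)
      (cms_finite₂ f)]
    refine finsum_congr fun l => Finset.sum_congr rfl fun i hi => ?_
    rw [Nat.sub_add_cancel (Finset.mem_Ico.mp hi).2.le]
  calc E (delta (partialCoeff f))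
    _ = ∑ᶠ l : ℕ+, E (delta (monomial l (partialP l f))) :=
        map_partialCoeff (E.comp delta).toAddMonoidHom f
    _ = _ := by
        simp only [E_delta_monomial, ← mul_finsum]
        rw [finsum_sub_distrib ((hlead.union hmid).subset (Function.support_add _ _))
          (cms_finite₃ f),
          finsum_add_distrib hlead hmid, ← mul_finsum, hreindex]

theorem D_C (k : ℂ) (f : LambdaBar) : D k (C f) = partialCoeff f := by
  have hdelta : delta (C f) = 0 := by
    rw [← monomial_zero_left, delta_monomial, deltaPow, if_pos rfl, mul_zero]
  change partialD (C f) - (1 / 2 * k) • delta (C f) = _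
  rw [hdelta, smul_zero, sub_zero, partialD_C]

theorem L_two_apply (k : ℂ) (f : LambdaBar) : L k 2 f =
    E (partialD (partialCoeff f)) - (1 / 2 * k) • E (delta (partialCoeff f)) := by
  change E (D k (D k (C f))) = _
  rw [D_C]
  exact ((E.restrictScalars ℂ).map_sub _ _).trans
    (congrArg _ ((E.restrictScalars ℂ).map_smul _ _))

theorem L_two_eq_cmsInfinity (k : ℂ) (f : LambdaBar) : L k 2 f = cmsInfinity k f := by
  rw [L_two_apply, E_partialD_partialCoeff, E_delta_partialCoeff, cmsInfinity, two_mul,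
    ← two_smul ℂ]
  module

end SecondOperator

end DunklHeckman

end

theorem mainTheorem5 (k : ℂ) :
    (∀ r s : ℕ, ⁅DunklHeckman.L k r, DunklHeckman.L k s⁆ = 0) ∧
      (∀ f : DunklHeckman.LambdaBar,
        DunklHeckman.L k 2 f = DunklHeckman.cmsInfinity k f) :=
  ⟨DunklHeckman.L_commute k, DunklHeckman.L_two_eq_cmsInfinity k⟩
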